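/- Let \(n\ge 1\), \(\phi,\bar w\in\mathbb R\), and let \(\mathcal G_n\) be the set of real symmetric \(n\times n\) matrices \(g\) with all entries in \([0,\bar w]\) and zero diagonal. In the network game in which player \(i\) chooses \(x_i\in\mathbb R\) and has payoff \(\pi_i=a_ix_i-\tfrac12x_i^2+\phi\sum_j g_{ij}x_ix_j\), let \(x^*(a,g)=[I-\phi g]^{-1}a\) be the equilibrium profile and let \(V(a,g)=2\sum_i\pi_i(x^*(a,g))=a^T[I-\phi g]^{-2}a\). Fix \(\hat g\in\mathcal G_n\) and \(\hat a\in\mathbb R^n\). Write \(\lambda_1(m)\) for the largest eigenvalue of a symmetric matrix \(m\), and \(\|\cdot\|\) for the Euclidean norm of vectors and the Frobenius norm of matrices. For a budget \(C\ge 0\) and \(0<\kappa<\infty\), put \[V^*_{single}(\hat g,\hat a,C)=\max\{V(a,\hat g): a\in\mathbb R^n,\ \|a-\hat a\|^2\le C\},\] \[V^*_{joint}(\hat g,\hat a,C)=\max\{V(a,g): a\in\mathbb R^n,\ g\in\mathcal G_n,\ \kappa\|g-\hat g\|^2+\|a-\hat a\|^2\le C\}.\] (1) Single intervention. If \(\lambda_1(\phi\hat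 g)<1\), then the maximum \(V^*_{single}\) is attained for every \(C\ge0\) and \[\lim_{C\to\infty}\frac{V^*_{single}(\hat g,\hat a,C)}{C}=\frac{1}{(1-\lambda_1(\phi\hat g))^2}.\] (2) Joint intervention. Suppose that \(\bar w<\frac{1}{\phi(n-1)}\) if \(\phi>0\), that \(\bar w<-\frac{2}{\phi n}\) if \(\phi<0\) and \(n\) is even, and that \(\bar w<-\frac{2}{\phi\sqrt{n^2-1}}\) if \(\phi<0\) and \(n\) is odd (for \(n=1\), where the denominator is zero, there is no restriction). Then \(\lambda_1(\phi g)<1\) for all \(g\in\mathcal G_n\) and, for every \(\kappa\in(0,\infty)\), the maximum \(V^*_{joint}\) is attained for every \(C\ge0\), and \[\lim_{C\to\infty}\frac{V^*_{joint}(\hat g,\hat a,C)}{C}=\begin{cases}\dfrac{1}{(1-(n-1)\phi\bar w)^2},&\phi>0;\\[2ex]\dfrac{1}{\left(1+\phi\bar w\sqrt{\lfloor n/2\rfloor\lceil n/2\rceil}\right)^2},&\phi<0.\end{cases}\] -/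

import Mathlib

open Filter Topology Matrix

namespace NetworkIntervention

/-- The admissible networks on `n` players: symmetric weights in `[0, wbar]`, no self-loops. -/
def networkSpace (n : ℕ) (wbar : ℝ) : Set (Matrix (Fin n) (Fin n) ℝ) :=
  {g | (∀ i j, g i j = g j i) ∧ (∀ i j, g i j ∈ Set.Icc 0 wbar) ∧ ∀ k, g k k = 0}

/-- Payoff of player `i` at the action profile `x`, with standalone marginal utilities `a`. -/
noncomputable def payoff {n : ℕ} (φ : ℝ) (g : Matrix (Fin n) (Fin n) ℝ) (a x : Fin n → ℝ)
    (i : Fin n) : ℝ :=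
  a i * x i - 1 / 2 * x i ^ 2 + φ * ∑ j, g i j * x i * x j

/-- `x` is a Nash equilibrium: no player gains from a unilateral deviation. -/
def IsEquilibrium {n : ℕ} (φ : ℝ) (g : Matrix (Fin n) (Fin n) ℝ) (a x : Fin n → ℝ) : Prop :=
  ∀ (i : Fin n) (y : ℝ), payoff φ g a (Function.update x i y) i ≤ payoff φ g a x i

/-- The equilibrium profile `x* = [I - φ g]⁻¹ a`. -/
noncomputable def eqAction {n : ℕ} (φ : ℝ) (g : Matrix (Fin n) (Fin n) ℝ) (a : Fin n → ℝ) :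
    Fin n → ℝ :=
  (1 - φ • g)⁻¹ *ᵥ a

/-- The planner's objective: twice the total payoff at the equilibrium profile. -/
noncomputable def welfare {n : ℕ} (φ : ℝ) (g : Matrix (Fin n) (Fin n) ℝ) (a : Fin n → ℝ) : ℝ :=
  2 * ∑ i, payoff φ g a (eqAction φ g a) i

/-- The squared Euclidean norm. -/
def normSq {n : ℕ} (v : Fin n → ℝ) : ℝ := ∑ i, v i ^ 2

/-- The squared Frobenius norm. -/
def frobSq {n : ℕ} (h : Matrix (Fin n) (Fin n) ℝ) : ℝ := ∑ i, ∑ j, h i j ^ 2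

/-- The largest real eigenvalue. -/
noncomputable def lambdaMax {n : ℕ} (m : Matrix (Fin n) (Fin n) ℝ) : ℝ := sSup (spectrum ℝ m)

/-- Welfare levels attainable by an intervention on `a` alone, with budget `C`. -/
def singleValues {n : ℕ} (φ : ℝ) (g : Matrix (Fin n) (Fin n) ℝ) (ahat : Fin n → ℝ) (C : ℝ) :
    Set ℝ :=
  {v | ∃ a : Fin n → ℝ, normSq (a - ahat) ≤ C ∧ v = welfare φ g a}

/-- Welfare levels attainable by a joint intervention on `a` and `g`, with budget `C`. -/
def jointValues {n : ℕ} (φ wbar κ : ℝ) (ghat : Matrix (Fin n) (Fin n) ℝ) (ahat : Fin n → ℝ)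
    (C : ℝ) : Set ℝ :=
  {v | ∃ (a : Fin n → ℝ) (g : Matrix (Fin n) (Fin n) ℝ), g ∈ networkSpace n wbar ∧
    κ * frobSq (g - ghat) + normSq (a - ahat) ≤ C ∧ v = welfare φ g a}

/-- The value function of the single intervention. -/
noncomputable def Vsingle {n : ℕ} (φ : ℝ) (ghat : Matrix (Fin n) (Fin n) ℝ) (ahat : Fin n → ℝ)
    (C : ℝ) : ℝ :=
  sSup (singleValues φ ghat ahat C)

/-- The value function of the joint intervention. -/
noncomputable def Vjoint {n : ℕ} (φ wbar κ : ℝ) (ghat : Matrix (Fin n) (Fin n) ℝ)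
    (ahat : Fin n → ℝ) (C : ℝ) : ℝ :=
  sSup (jointValues φ wbar κ ghat ahat C)

/-- The upper bound on link weights: `wbar < 1 / (φ (n-1))` if `φ > 0`; `wbar < -2 / (φ n)` if
`φ < 0` and `n` is even; `wbar < -2 / (φ √(n²-1))` if `φ < 0` and `n` is odd. The denominators are
cleared, so that for `n = 1` the bound reads `wbar < ∞`. -/
def WeightBound (n : ℕ) (φ wbar : ℝ) : Prop :=
  (0 < φ → wbar * (φ * ((n : ℝ) - 1)) < 1) ∧
  (φ < 0 → Even n → wbar * (-φ * n) < 2) ∧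
  (φ < 0 → Odd n → wbar * (-φ * Real.sqrt ((n : ℝ) ^ 2 - 1)) < 2)

/-- For a symmetric matrix of positive size, `lambdaMax` is attained in the spectrum. -/
theorem isGreatest_lambdaMax {n : ℕ} (hn : 1 ≤ n) {m : Matrix (Fin n) (Fin n) ℝ}
    (hm : ∀ i j, m i j = m j i) : IsGreatest (spectrum ℝ m) (lambdaMax m) := by
  have hH : m.IsHermitian := by
    ext i j
    simpa [Matrix.conjTranspose_apply] using hm j i
  have hs := hH.spectrum_real_eq_range_eigenvalues
  have hfin : (spectrum ℝ m).Finite := by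
    rw [hs]; exact Set.finite_range _
  have hne : (spectrum ℝ m).Nonempty := by
    rw [hs]; exact ⟨_, ⟨⟨0, hn⟩, rfl⟩⟩
  exact ⟨hne.csSup_mem hfin, fun x hx => le_csSup hfin.bddAbove hx⟩

theorem isEquilibrium_iff {n : ℕ} {φ : ℝ} {g : Matrix (Fin n) (Fin n) ℝ}
    (hg : ∀ k, g k k = 0) (hu : IsUnit (1 - φ • g).det) (a x : Fin n → ℝ) :
    IsEquilibrium φ g a x ↔ x = eqAction φ g a := by
  have key : ∀ (i : Fin n) (y : ℝ), payoff φ g a (Function.update x i y) i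
      = a i * y - 1 / 2 * y ^ 2 + φ * y * ∑ j, g i j * x j := by
    intro i y
    have : ∑ j, g i j * y * Function.update x i y j = y * ∑ j, g i j * x j := by
      rw [Finset.mul_sum]
      refine Finset.sum_congr rfl fun j _ => ?_
      by_cases h : j = i
      · subst h; simp [hg]
      · rw [Function.update_of_ne h]; ring
    simp only [payoff, Function.update_self, this]
    ring
  have key0 : ∀ i : Fin n, payoff φ g a x i
      = a i * x i - 1 / 2 * x i ^ 2 + φ * x i * ∑ j, g i j * x j := by
    intro i
    have := key i (x i)
    rwa [Function.update_eq_self] at this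
  have foc : IsEquilibrium φ g a x ↔ (1 - φ • g) *ᵥ x = a := by
    have e : ∀ i, ((1 - φ • g) *ᵥ x) i = x i - φ * ∑ j, g i j * x j := by
      intro i
      rw [Matrix.sub_mulVec, Matrix.one_mulVec, Matrix.smul_mulVec]
      simp [Matrix.mulVec, dotProduct]
    constructor
    · intro h
      ext i
      rw [e]
      have := h i (a i + φ * ∑ j, g i j * x j)
      rw [key, key0] at this
      have h2 : (a i + φ * ∑ j, g i j * x j - x i) ^ 2 ≤ 0 := by nlinarith
      have h3 := pow_eq_zero_iff (two_ne_zero) |>.1 (le_antisymm h2 (sq_nonneg _))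
      linarith
    · intro h i y
      have h1 := congrFun h i
      rw [e] at h1
      rw [key, key0, ← h1]
      nlinarith [sq_nonneg (y - x i)]
  rw [foc, eqAction]
  constructor
  · intro h
    rw [← h, Matrix.mulVec_mulVec, Matrix.nonsing_inv_mul _ hu, Matrix.one_mulVec]
  · intro h
    rw [h, Matrix.mulVec_mulVec, Matrix.mul_nonsing_inv _ hu, Matrix.one_mulVec]

/-- The objective is the quadratic form `aᵀ [I - φ g]⁻² a`. -/
theorem welfare_eq {n : ℕ} {φ : ℝ} {g : Matrix (Fin n) (Fin n) ℝ}
    (hg : ∀ i j, g i j = g j i) (hu : IsUnit (1 - φ • g).det) (a : Fin n → ℝ) :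
    welfare φ g a = a ⬝ᵥ (((1 - φ • g)⁻¹ ^ 2) *ᵥ a) := by
  have hT : (1 - φ • g)ᵀ = 1 - φ • g := by
    ext i j
    simp [Matrix.one_apply, hg i j, eq_comm]
  have hiT : ((1 - φ • g)⁻¹)ᵀ = (1 - φ • g)⁻¹ := by
    rw [Matrix.transpose_nonsing_inv, hT]
  have hx : (1 - φ • g) *ᵥ eqAction φ g a = a := by
    rw [eqAction, Matrix.mulVec_mulVec, Matrix.mul_nonsing_inv _ hu, Matrix.one_mulVec]
  have h1 : welfare φ g a = eqAction φ g a ⬝ᵥ eqAction φ g a := by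
    simp only [welfare, payoff, dotProduct]
    rw [Finset.mul_sum]
    refine Finset.sum_congr rfl fun i _ => ?_
    have e := congrFun hx i
    rw [Matrix.sub_mulVec, Matrix.one_mulVec, Matrix.smul_mulVec] at e
    simp only [Pi.sub_apply, Pi.smul_apply, Matrix.mulVec, dotProduct, smul_eq_mul] at e
    have e2 : ∑ j, g i j * eqAction φ g a i * eqAction φ g a j
        = eqAction φ g a i * ∑ j, g i j * eqAction φ g a j := by
      rw [Finset.mul_sum]
      exact Finset.sum_congr rfl fun j _ => by ring
    rw [e2, ← e]
    ring
  rw [h1, pow_two, ← Matrix.mulVec_mulVec, Matrix.dotProduct_mulVec, ← Matrix.mulVec_transpose,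
    hiT]
  rfl

end NetworkIntervention

open NetworkIntervention

namespace NetworkIntervention

/-! ### Squared Euclidean norm. -/

variable {n : ℕ} {φ L : ℝ} {g : Matrix (Fin n) (Fin n) ℝ}

/-! Welfare is the squared norm of the equilibrium profile. Let the network range over a compact set
`S` on which every Rayleigh quotient of `φ • g` is at most `L < 1`. Then `‖x*‖ ≤ ‖a‖ / (1 - L)`, so
a budget `C` buys at most `(‖ahat‖ + √C)² / (1 - L)²`. Conversely, if some `g ∈ S` has an
eigenvector of `φ • g` with eigenvalue `L`, one pays the fixed cost of moving to `g` and spends the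
rest along that eigenvector, which gives at least `(C - const) / (1 - L)²`. Both bounds are
asymptotic to `C / (1 - L)²`; this is `tendsto_sSup_valuesOn`.

The single intervention is `S = {ghat}`, the joint one `S = networkSpace n wbar`. For the latter it
remains to maximise the largest eigenvalue of `φ • g`. For `φ > 0` the complete network is extremal.
For `φ < 0` only links between coordinates of opposite sign help, so the balanced complete bipartite
network is extremal (`two_mul_posPart_sum_mul_negPart_sum_le`, `exists_bipartite_eigenvector`). -/

theorem normSq_eq_dotProduct (v : Fin n → ℝ) : normSq v = v ⬝ᵥ v := by
  simp [normSq, dotProduct, pow_two]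

theorem normSq_nonneg (v : Fin n → ℝ) : 0 ≤ normSq v :=
  Finset.sum_nonneg fun _ _ => sq_nonneg _

theorem normSq_pos {v : Fin n → ℝ} (hv : v ≠ 0) : 0 < normSq v := by
  refine lt_of_le_of_ne (normSq_nonneg v) fun h => hv ?_
  rw [normSq_eq_dotProduct] at h
  exact dotProduct_self_eq_zero.1 h.symm

theorem normSq_smul (t : ℝ) (v : Fin n → ℝ) : normSq (t • v) = t ^ 2 * normSq v := by
  simp [normSq, mul_pow, Finset.mul_sum]

theorem normSq_add (v w : Fin n → ℝ) :
    normSq (v + w) = normSq v + 2 * (v ⬝ᵥ w) + normSq w := by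
  simp only [normSq_eq_dotProduct, add_dotProduct, dotProduct_add, dotProduct_comm w v]
  ring

theorem normSq_sub (v w : Fin n → ℝ) :
    normSq (v - w) = normSq v - 2 * (v ⬝ᵥ w) + normSq w := by
  simp only [normSq_eq_dotProduct, sub_dotProduct, dotProduct_sub, dotProduct_comm w v]
  ring

theorem dotProduct_le_sqrt (v w : Fin n → ℝ) : v ⬝ᵥ w ≤ √(normSq v) * √(normSq w) :=
  Real.sum_mul_le_sqrt_mul_sqrt _ _ _

/-! ### Rayleigh bounds and the equilibrium response. -/

/-- `L` bounds the Rayleigh quotient of `m` from above. -/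
def RayleighLE (m : Matrix (Fin n) (Fin n) ℝ) (L : ℝ) : Prop :=
  ∀ x : Fin n → ℝ, x ⬝ᵥ (m *ᵥ x) ≤ L * normSq x

/-- A kernel vector of `1 - m` would be an eigenvector of `m` for the eigenvalue `1 > L`. -/
theorem RayleighLE.isUnit_det {m : Matrix (Fin n) (Fin n) ℝ} (h : RayleighLE m L) (hL : L < 1) :
    IsUnit (1 - m).det := by
  rw [isUnit_iff_ne_zero]
  intro h0
  obtain ⟨v, hv, hv0⟩ := Matrix.exists_mulVec_eq_zero_iff.2 h0
  rw [Matrix.sub_mulVec, Matrix.one_mulVec, sub_eq_zero] at hv0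
  have h1 := h v
  rw [← hv0, ← normSq_eq_dotProduct] at h1
  nlinarith [normSq_pos hv]

theorem sub_mulVec_eqAction (hu : IsUnit (1 - φ • g).det) (a : Fin n → ℝ) :
    (1 - φ • g) *ᵥ eqAction φ g a = a := by
  rw [eqAction, Matrix.mulVec_mulVec, Matrix.mul_nonsing_inv _ hu, Matrix.one_mulVec]

theorem eqAction_eq_of_mulVec_eq (hu : IsUnit (1 - φ • g).det) {a x : Fin n → ℝ}
    (h : (1 - φ • g) *ᵥ x = a) : eqAction φ g a = x := by
  rw [eqAction, ← h, Matrix.mulVec_mulVec, Matrix.nonsing_inv_mul _ hu, Matrix.one_mulVec]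

theorem welfare_eq_normSq (hg : ∀ i j, g i j = g j i) (hu : IsUnit (1 - φ • g).det)
    (a : Fin n → ℝ) : welfare φ g a = normSq (eqAction φ g a) := by
  have hT : ((1 - φ • g)⁻¹)ᵀ = (1 - φ • g)⁻¹ := by
    rw [Matrix.transpose_nonsing_inv]
    congr 1
    ext i j
    simp [Matrix.one_apply, hg i j, eq_comm]
  rw [welfare_eq hg hu, pow_two, ← Matrix.mulVec_mulVec, Matrix.dotProduct_mulVec,
    ← Matrix.mulVec_transpose, hT, normSq_eq_dotProduct, eqAction]

theorem RayleighLE.normSq_eqAction_le (h : RayleighLE (φ • g) L) (hL : L < 1) (a : Fin n → ℝ) :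
    (1 - L) ^ 2 * normSq (eqAction φ g a) ≤ normSq a := by
  have hy := sub_mulVec_eqAction (h.isUnit_det hL) a
  set y := eqAction φ g a
  have h1 : (1 - L) * normSq y ≤ a ⬝ᵥ y := by
    rw [← hy, dotProduct_comm, Matrix.sub_mulVec, Matrix.one_mulVec, dotProduct_sub,
      ← normSq_eq_dotProduct]
    linarith [h y]
  -- Expanding this square replaces Cauchy–Schwarz: it bounds `2 (1 - L) (a ⬝ᵥ y)` by `normSq a + (1
  -- - L)² normSq y`, with no division by `‖y‖`.
  have h2 := normSq_nonneg (a - (1 - L) • y)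
  rw [normSq_sub, normSq_smul, dotProduct_smul, smul_eq_mul] at h2
  nlinarith

theorem eqAction_add_smul (hu : IsUnit (1 - φ • g).det) (hL : L < 1) {u : Fin n → ℝ}
    (hgu : (φ • g) *ᵥ u = L • u) (a : Fin n → ℝ) (t : ℝ) :
    eqAction φ g (a + t • u) = eqAction φ g a + (t / (1 - L)) • u := by
  apply eqAction_eq_of_mulVec_eq hu
  rw [Matrix.mulVec_add, sub_mulVec_eqAction hu, Matrix.mulVec_smul, Matrix.sub_mulVec,
    Matrix.one_mulVec, hgu]
  have : u - L • u = (1 - L) • u := by rw [sub_smul, one_smul]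
  rw [this, smul_smul, div_mul_cancel₀ _ (by linarith)]

/-! ### Value function over a compact set of networks. -/

/-- Welfare levels attainable with budget `C` when the network ranges over `S`. -/
def valuesOn (S : Set (Matrix (Fin n) (Fin n) ℝ)) (φ κ : ℝ) (ghat : Matrix (Fin n) (Fin n) ℝ)
    (ahat : Fin n → ℝ) (C : ℝ) : Set ℝ :=
  {v | ∃ (a : Fin n → ℝ) (g : Matrix (Fin n) (Fin n) ℝ), g ∈ S ∧
    κ * frobSq (g - ghat) + normSq (a - ahat) ≤ C ∧ v = welfare φ g a}

/-- On `{ghat}` the network cost vanishes, so the weight `1` is arbitrary. `jointValues` is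
`valuesOn` of `networkSpace` by definition. -/
theorem singleValues_eq (ghat : Matrix (Fin n) (Fin n) ℝ) (ahat : Fin n → ℝ) (C : ℝ) :
    singleValues φ ghat ahat C = valuesOn {ghat} φ 1 ghat ahat C := by
  ext v
  simp [singleValues, valuesOn, frobSq]

variable {S : Set (Matrix (Fin n) (Fin n) ℝ)} {κ : ℝ} {ghat : Matrix (Fin n) (Fin n) ℝ}
  {ahat : Fin n → ℝ}

theorem frobSq_nonneg (h : Matrix (Fin n) (Fin n) ℝ) : 0 ≤ frobSq h :=
  Finset.sum_nonneg fun _ _ => Finset.sum_nonneg fun _ _ => sq_nonneg _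

theorem continuous_frobSq : Continuous (frobSq (n := n)) := by
  unfold frobSq
  exact continuous_finsetSum _ fun i _ => continuous_finsetSum _ fun j _ =>
    (continuous_id.matrix_elem i j).pow 2

theorem continuous_normSq : Continuous (normSq (n := n)) := by
  unfold normSq
  fun_prop

theorem isCompact_budget (hS : IsCompact S) (hκ : 0 < κ) (C : ℝ) :
    IsCompact {p : (Fin n → ℝ) × Matrix (Fin n) (Fin n) ℝ |
      p.2 ∈ S ∧ κ * frobSq (p.2 - ghat) + normSq (p.1 - ahat) ≤ C} := by
  -- The network cost is nonnegative, so the budget keeps each coordinate of `a` within `√C` of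
  -- `ahat`.
  have hK : IsCompact ((Set.univ.pi fun i => Set.Icc (ahat i - √C) (ahat i + √C)) ×ˢ S) :=
    (isCompact_univ_pi fun _ => isCompact_Icc).prod hS
  refine hK.of_isClosed_subset ?_ ?_
  · refine (hS.isClosed.preimage continuous_snd).inter
      (isClosed_Iic.preimage (f := fun p : (Fin n → ℝ) × Matrix (Fin n) (Fin n) ℝ =>
        κ * frobSq (p.2 - ghat) + normSq (p.1 - ahat)) ?_)
    exact (continuous_const.mul (continuous_frobSq.comp (continuous_snd.sub continuous_const))).add
      (continuous_normSq.comp (continuous_fst.sub continuous_const))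
  · rintro ⟨a, g⟩ ⟨hg, hC⟩
    refine ⟨fun i _ => ?_, hg⟩
    have h1 : (a i - ahat i) ^ 2 ≤ normSq (a - ahat) :=
      Finset.single_le_sum (f := fun i => (a - ahat) i ^ 2) (fun _ _ => sq_nonneg _)
        (Finset.mem_univ i)
    have h2 := mul_nonneg hκ.le (frobSq_nonneg (g - ghat))
    have h3 := abs_le.1 (Real.abs_le_sqrt (h1.trans (by dsimp only at hC; linarith : _ ≤ C)))
    exact ⟨by linarith [h3.1], by linarith [h3.2]⟩

theorem isGreatest_valuesOn (hS : IsCompact S) (hghat : ghat ∈ S) (hκ : 0 < κ)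
    (hsymm : ∀ g ∈ S, ∀ i j, g i j = g j i) (hu : ∀ g ∈ S, IsUnit (1 - φ • g).det)
    {C : ℝ} (hC : 0 ≤ C) :
    IsGreatest (valuesOn S φ κ ghat ahat C) (sSup (valuesOn S φ κ ghat ahat C)) := by
  set K := {p : (Fin n → ℝ) × Matrix (Fin n) (Fin n) ℝ |
      p.2 ∈ S ∧ κ * frobSq (p.2 - ghat) + normSq (p.1 - ahat) ≤ C} with hKdef
  have hK : IsCompact K := isCompact_budget hS hκ C
  have hcont : ContinuousOn
      (fun p : (Fin n → ℝ) × Matrix (Fin n) (Fin n) ℝ => normSq (eqAction φ p.2 p.1)) K := by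
    have hM : Continuous fun p : (Fin n → ℝ) × Matrix (Fin n) (Fin n) ℝ => 1 - φ • p.2 :=
      continuous_const.sub (continuous_snd.const_smul φ)
    have hinv : ContinuousOn
        (fun p : (Fin n → ℝ) × Matrix (Fin n) (Fin n) ℝ => (1 - φ • p.2)⁻¹) K := by
      -- The inverse is `det⁻¹ • adjugate`, hence continuous where the determinant does not vanish.
      simp only [Matrix.inv_def, Ring.inverse_eq_inv']
      exact (hM.matrix_det.continuousOn.inv₀ fun p hp => (hu _ hp.1).ne_zero).smul
        hM.matrix_adjugate.continuousOn
    refine continuous_normSq.comp_continuousOn ?_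
    rw [continuousOn_iff_continuous_domRestrict] at hinv ⊢
    exact Continuous.matrix_mulVec hinv (continuous_fst.comp continuous_subtype_val)
  have himg : valuesOn S φ κ ghat ahat C =
      (fun p : (Fin n → ℝ) × Matrix (Fin n) (Fin n) ℝ => normSq (eqAction φ p.2 p.1)) '' K := by
    ext v
    constructor
    · rintro ⟨a, g, hg, hle, rfl⟩
      exact ⟨(a, g), ⟨hg, hle⟩, (welfare_eq_normSq (hsymm g hg) (hu g hg) a).symm⟩
    · rintro ⟨⟨a, g⟩, ⟨hg, hle⟩, rfl⟩
      exact ⟨a, g, hg, hle, (welfare_eq_normSq (hsymm g hg) (hu g hg) a).symm⟩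
  rw [himg]
  refine (hK.image_of_continuousOn hcont).isGreatest_sSup (Set.Nonempty.image _ ?_)
  exact ⟨(ahat, ghat), hghat, by simpa [frobSq, normSq] using hC⟩

/-- The bracket is `(‖ahat‖ + √C)²`, expanded so that it can be divided by `C` term by term. -/
theorem le_of_mem_valuesOn (hκ : 0 < κ) (hsymm : ∀ g ∈ S, ∀ i j, g i j = g j i)
    (hR : ∀ g ∈ S, RayleighLE (φ • g) L) (hL : L < 1) {C v : ℝ}
    (hv : v ∈ valuesOn S φ κ ghat ahat C) :
    v ≤ 1 / (1 - L) ^ 2 * (normSq ahat + 2 * √(normSq ahat) * √C + C) := by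
  obtain ⟨a, g, hg, hle, rfl⟩ := hv
  rw [welfare_eq_normSq (hsymm g hg) ((hR g hg).isUnit_det hL)]
  have hpos : 0 < (1 - L) ^ 2 := pow_pos (by linarith) 2
  have h1 := (hR g hg).normSq_eqAction_le hL a
  have h2 := mul_nonneg hκ.le (frobSq_nonneg (g - ghat))
  have h3 : normSq (a - ahat) ≤ C := by linarith
  have h4 : normSq a ≤ normSq ahat + 2 * √(normSq ahat) * √C + C := by
    have h5 := normSq_add ahat (a - ahat)
    rw [add_sub_cancel] at h5
    have h6 := dotProduct_le_sqrt ahat (a - ahat)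
    have h7 := mul_le_mul_of_nonneg_left (Real.sqrt_le_sqrt h3) (Real.sqrt_nonneg (normSq ahat))
    nlinarith
  rw [one_div, ← div_eq_inv_mul, le_div_iff₀ hpos]
  linarith

theorem exists_mem_valuesOn (hsymm : ∀ g ∈ S, ∀ i j, g i j = g j i)
    (hR : ∀ g ∈ S, RayleighLE (φ • g) L) (hL : L < 1) (hg : g ∈ S) {u : Fin n → ℝ} (hu : u ≠ 0)
    (hgu : (φ • g) *ᵥ u = L • u) {C : ℝ} (hC : κ * frobSq (g - ghat) ≤ C) :
    ∃ v ∈ valuesOn S φ κ ghat ahat C, 1 / (1 - L) ^ 2 * (C - κ * frobSq (g - ghat)) ≤ v := by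
  have hdet := (hR g hg).isUnit_det hL
  -- The sign of `u` is free; it is chosen to make the cross term in the norm of the new equilibrium
  -- nonnegative.
  obtain ⟨u, hu, hgu, hb⟩ : ∃ u : Fin n → ℝ, u ≠ 0 ∧ (φ • g) *ᵥ u = L • u ∧
      0 ≤ eqAction φ g ahat ⬝ᵥ u := by
    rcases le_total 0 (eqAction φ g ahat ⬝ᵥ u) with h | h
    · exact ⟨u, hu, hgu, h⟩
    · refine ⟨-u, neg_ne_zero.2 hu, by rw [Matrix.mulVec_neg, hgu, smul_neg], ?_⟩
      rw [dotProduct_neg]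
      linarith
  set D := C - κ * frobSq (g - ghat) with hD
  have hD0 : 0 ≤ D := by linarith
  have hup := normSq_pos hu
  -- This step length exhausts the budget `D` left after the network has been changed.
  set t := √(D / normSq u)
  have ht : t ^ 2 * normSq u = D := by
    rw [Real.sq_sqrt (by positivity), div_mul_cancel₀ _ hup.ne']
  refine ⟨_, ⟨ahat + t • u, g, hg, ?_, rfl⟩, ?_⟩
  · rw [add_sub_cancel_left, normSq_smul, ht]
    linarith
  · rw [welfare_eq_normSq (hsymm g hg) hdet, eqAction_add_smul hdet hL hgu, normSq_add,
      normSq_smul, dotProduct_smul, smul_eq_mul]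
    have h1 : (t / (1 - L)) ^ 2 * normSq u = 1 / (1 - L) ^ 2 * D := by
      rw [← ht, div_pow]; ring
    have h2 : 0 ≤ t / (1 - L) := div_nonneg (Real.sqrt_nonneg _) (by linarith)
    have h3 := mul_nonneg h2 hb
    linarith [normSq_nonneg (eqAction φ g ahat)]

theorem tendsto_sSup_valuesOn (hS : IsCompact S) (hghat : ghat ∈ S) (hκ : 0 < κ)
    (hsymm : ∀ g ∈ S, ∀ i j, g i j = g j i) (hR : ∀ g ∈ S, RayleighLE (φ • g) L) (hL : L < 1)
    (hg : g ∈ S) {u : Fin n → ℝ} (hu : u ≠ 0) (hgu : (φ • g) *ᵥ u = L • u) :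
    Tendsto (fun C : ℝ => sSup (valuesOn S φ κ ghat ahat C) / C) atTop
      (𝓝 (1 / (1 - L) ^ 2)) := by
  set c := 1 / (1 - L) ^ 2
  set k := κ * frobSq (g - ghat)
  have hmax : ∀ C : ℝ, 0 ≤ C → _ := fun C hC => isGreatest_valuesOn (ahat := ahat) hS hghat hκ
    hsymm (fun g hg => (hR g hg).isUnit_det hL) hC
  have hlow : Tendsto (fun C : ℝ => c * (1 - k * C⁻¹)) atTop (𝓝 c) := by
    simpa using ((tendsto_inv_atTop_zero.const_mul k).const_sub 1).const_mul c
  have hup : Tendsto (fun C : ℝ => c * (normSq ahat * C⁻¹ +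
      2 * √(normSq ahat) * (√C)⁻¹ + 1)) atTop (𝓝 c) := by
    have h1 := (tendsto_inv_atTop_zero (𝕜 := ℝ)).const_mul (normSq ahat)
    have h2 := (tendsto_inv_atTop_zero.comp Real.tendsto_sqrt_atTop).const_mul
      (2 * √(normSq ahat))
    simpa using ((h1.add h2).add_const 1).const_mul c
  refine tendsto_of_tendsto_of_tendsto_of_le_of_le' hlow hup ?_ ?_
  -- From `C ≥ k` on, the extremal network is affordable.
  · filter_upwards [eventually_ge_atTop k, eventually_gt_atTop 0] with C hCk hC
    obtain ⟨v, hv, hle⟩ := exists_mem_valuesOn (ahat := ahat) hsymm hR hL hg hu hgu hCk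
    have h1 := hle.trans ((hmax C hC.le).2 hv)
    rw [le_div_iff₀ hC]
    refine le_trans (le_of_eq ?_) h1
    change c * (1 - k * C⁻¹) * C = c * (C - k)
    have hi : C⁻¹ * C = 1 := inv_mul_cancel₀ hC.ne'
    linear_combination (-c * k) * hi
  · filter_upwards [eventually_gt_atTop 0] with C hC
    have h1 := le_of_mem_valuesOn hκ hsymm hR hL (hmax C hC.le).1
    rw [div_le_iff₀ hC]
    refine h1.trans (le_of_eq ?_)
    have hs : (√C)⁻¹ * C = √C := by
      rw [← div_eq_inv_mul, Real.div_sqrt]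
    have hi : C⁻¹ * C = 1 := inv_mul_cancel₀ hC.ne'
    linear_combination (-c * normSq ahat) * hi - c * 2 * √(normSq ahat) * hs

/-! ### Largest eigenvalue and Rayleigh quotient. -/

theorem exists_eigenvector_of_mem_spectrum {m : Matrix (Fin n) (Fin n) ℝ} {l : ℝ}
    (hl : l ∈ spectrum ℝ m) : ∃ u : Fin n → ℝ, u ≠ 0 ∧ m *ᵥ u = l • u := by
  rw [← Matrix.spectrum_toLin', ← Module.End.hasEigenvalue_iff_mem_spectrum] at hl
  obtain ⟨u, hu⟩ := hl.exists_hasEigenvector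
  exact ⟨u, hu.2, by simpa using hu.apply_eq_smul⟩

/-- The eigenvalues of `lambdaMax m • 1 - m` are the differences `lambdaMax m - b` with `b` in the
spectrum of `m`, so this matrix is positive semidefinite. -/
theorem rayleighLE_lambdaMax (hn : 1 ≤ n) {m : Matrix (Fin n) (Fin n) ℝ}
    (hm : ∀ i j, m i j = m j i) : RayleighLE m (lambdaMax m) := by
  have hgr := isGreatest_lambdaMax hn hm
  have hH : (lambdaMax m • (1 : Matrix (Fin n) (Fin n) ℝ) - m).IsHermitian := by
    ext i j
    simp [Matrix.one_apply, hm i j, eq_comm]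
  have hps : (lambdaMax m • (1 : Matrix (Fin n) (Fin n) ℝ) - m).PosSemidef := by
    rw [hH.posSemidef_iff_eigenvalues_nonneg]
    intro i
    have hmem : hH.eigenvalues i ∈
        spectrum ℝ (algebraMap ℝ (Matrix (Fin n) (Fin n) ℝ) (lambdaMax m) - m) := by
      rw [Algebra.algebraMap_eq_smul_one, hH.spectrum_real_eq_range_eigenvalues]
      exact ⟨i, rfl⟩
    rw [← spectrum.singleton_sub_eq] at hmem
    obtain ⟨_, rfl, b, hb, hbe⟩ := hmem
    have := hgr.2 hb
    simp only [Pi.zero_apply]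
    rw [← hbe]
    simpa using this
  intro x
  have := hps.dotProduct_mulVec_nonneg x
  rw [Matrix.sub_mulVec, Matrix.smul_mulVec, Matrix.one_mulVec, star_trivial, dotProduct_sub,
    dotProduct_smul, smul_eq_mul, ← normSq_eq_dotProduct] at this
  linarith

theorem RayleighLE.lambdaMax_le (hn : 1 ≤ n) {m : Matrix (Fin n) (Fin n) ℝ}
    (hm : ∀ i j, m i j = m j i) (h : RayleighLE m L) : lambdaMax m ≤ L := by
  obtain ⟨u, hu, hmu⟩ := exists_eigenvector_of_mem_spectrum (isGreatest_lambdaMax hn hm).1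
  have h1 := h u
  rw [hmu, dotProduct_smul, smul_eq_mul, ← normSq_eq_dotProduct] at h1
  exact le_of_mul_le_mul_right h1 (normSq_pos hu)

/-! ### Compactness of the network space, and the extremal network for `φ > 0`. -/

variable {wbar : ℝ}

theorem isCompact_networkSpace (n : ℕ) (wbar : ℝ) : IsCompact (networkSpace n wbar) := by
  have hK : IsCompact (Set.univ.pi fun _ : Fin n => Set.univ.pi fun _ : Fin n =>
      Set.Icc (0 : ℝ) wbar) :=
    isCompact_univ_pi fun _ => isCompact_univ_pi fun _ => isCompact_Icc
  refine hK.of_isClosed_subset ?_ fun g hg i _ j _ => hg.2.1 i j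
  have hc : ∀ i j : Fin n, Continuous fun g : Matrix (Fin n) (Fin n) ℝ => g i j :=
    fun i j => continuous_id.matrix_elem i j
  refine IsClosed.inter ?_ (IsClosed.inter ?_ ?_)
  · change IsClosed {g : Matrix (Fin n) (Fin n) ℝ | ∀ i j, g i j = g j i}
    simp only [Set.ofPred_forall]
    exact isClosed_iInter fun i => isClosed_iInter fun j => isClosed_eq (hc i j) (hc j i)
  · change IsClosed {g : Matrix (Fin n) (Fin n) ℝ | ∀ i j, g i j ∈ Set.Icc 0 wbar}
    simp only [Set.ofPred_forall]
    exact isClosed_iInter fun i => isClosed_iInter fun j => isClosed_Icc.preimage (hc i j)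
  · change IsClosed {g : Matrix (Fin n) (Fin n) ℝ | ∀ k, g k k = 0}
    simp only [Set.ofPred_forall]
    exact isClosed_iInter fun i => isClosed_eq (hc i i) continuous_const

theorem dotProduct_mulVec_eq_sum (m : Matrix (Fin n) (Fin n) ℝ) (x : Fin n → ℝ) :
    x ⬝ᵥ (m *ᵥ x) = ∑ i, ∑ j, m i j * (x i * x j) := by
  simp only [dotProduct, Matrix.mulVec, Finset.mul_sum]
  exact Finset.sum_congr rfl fun i _ => Finset.sum_congr rfl fun j _ => by ring

theorem rayleighLE_of_mem_networkSpace (hg : g ∈ networkSpace n wbar) (hφ : 0 ≤ φ) :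
    RayleighLE (φ • g) (((n : ℝ) - 1) * φ * wbar) := by
  intro x
  rw [Matrix.smul_mulVec, dotProduct_smul, smul_eq_mul, dotProduct_mulVec_eq_sum]
  have h1 : ∑ i, ∑ j, g i j * (x i * x j) ≤
      -- Termwise `2 * x i * x j ≤ x i ^ 2 + x j ^ 2`. The subtracted term cancels the diagonal,
      -- where `g i i = 0`, and turns the factor `n` into `n - 1`.
      ∑ i, ∑ j, (wbar * (x i ^ 2 + x j ^ 2) / 2 - if i = j then wbar * x i ^ 2 else 0) := by
    refine Finset.sum_le_sum fun i _ => Finset.sum_le_sum fun j _ => ?_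
    split_ifs with h
    · subst h
      rw [hg.2.2 i]
      linarith
    · have h2 := hg.2.1 i j
      nlinarith [mul_nonneg h2.1 (sq_nonneg (x i - x j)),
        mul_nonneg (sub_nonneg.2 h2.2) (add_nonneg (sq_nonneg (x i)) (sq_nonneg (x j)))]
  have h2 : ∑ i, ∑ j, (wbar * (x i ^ 2 + x j ^ 2) / 2 - if i = j then wbar * x i ^ 2 else 0) =
      ((n : ℝ) - 1) * wbar * normSq x := by
    simp only [Finset.sum_sub_distrib, Finset.sum_ite_eq, Finset.mem_univ, if_true, mul_add,
      add_div, Finset.sum_add_distrib, Finset.sum_const, Finset.card_univ, Fintype.card_fin,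
      nsmul_eq_mul, ← Finset.mul_sum, ← Finset.sum_div, normSq]
    ring
  rw [h2] at h1
  nlinarith [mul_le_mul_of_nonneg_left h1 hφ]

/-- The network in which all links have weight `w`. -/
def completeNetwork (n : ℕ) (w : ℝ) : Matrix (Fin n) (Fin n) ℝ :=
  Matrix.of fun i j => if i = j then 0 else w

theorem completeNetwork_mem (hw : 0 ≤ wbar) : completeNetwork n wbar ∈ networkSpace n wbar := by
  refine ⟨fun i j => by simp [completeNetwork, eq_comm], fun i j => ?_,
    fun k => by simp [completeNetwork]⟩
  simp only [completeNetwork, Matrix.of_apply]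
  split_ifs <;> simp [hw]

theorem completeNetwork_mulVec_one (n : ℕ) (w : ℝ) :
    completeNetwork n w *ᵥ 1 = (((n : ℝ) - 1) * w) • 1 := by
  ext i
  have h : ∀ j, completeNetwork n w i j = w - if i = j then w else 0 := fun j => by
    simp only [completeNetwork, Matrix.of_apply]
    split_ifs <;> simp
  simp only [Matrix.mulVec, dotProduct, h, Pi.one_apply, mul_one, Finset.sum_sub_distrib,
    Finset.sum_ite_eq, Finset.mem_univ, if_true, Finset.sum_const, Finset.card_univ,
    Fintype.card_fin, nsmul_eq_mul, Pi.smul_apply, smul_eq_mul]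
  ring

/-! ### Extremal network for `φ < 0`. -/

/-- The network in which exactly the links between `s` and its complement are present, all with
weight `w`. -/
def bipartiteNetwork (s : Finset (Fin n)) (w : ℝ) : Matrix (Fin n) (Fin n) ℝ :=
  Matrix.of fun i j => if (i ∈ s ↔ j ∈ s) then 0 else w

theorem bipartiteNetwork_mem (s : Finset (Fin n)) (hw : 0 ≤ wbar) :
    bipartiteNetwork s wbar ∈ networkSpace n wbar := by
  refine ⟨fun i j => by simp [bipartiteNetwork, iff_comm], fun i j => ?_,
    fun k => by simp [bipartiteNetwork]⟩
  simp only [bipartiteNetwork, Matrix.of_apply]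
  split_ifs <;> simp [hw]

/-- A vector with values `α` on `s` and `β` on `sᶜ` is sent to `w * |sᶜ| * β` on `s` and `w * |s| *
α` on `sᶜ`; the choice `√|sᶜ|`, `-√|s|` gives the negative eigenvalue of this two-dimensional
system. -/
theorem bipartiteNetwork_mulVec (s : Finset (Fin n)) (w : ℝ) :
    bipartiteNetwork s w *ᵥ (fun i => if i ∈ s then √(sᶜ.card : ℝ) else -√(s.card : ℝ)) =
      (-(w * √((s.card : ℝ) * (sᶜ.card : ℝ)))) •
        (fun i => if i ∈ s then √(sᶜ.card : ℝ) else -√(s.card : ℝ)) := by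
  have hp := Real.mul_self_sqrt (Nat.cast_nonneg (α := ℝ) s.card)
  have hq := Real.mul_self_sqrt (Nat.cast_nonneg (α := ℝ) sᶜ.card)
  rw [Real.sqrt_mul (Nat.cast_nonneg _)]
  ext i
  simp only [Matrix.mulVec, dotProduct, Pi.smul_apply, smul_eq_mul]
  rw [← Finset.sum_add_sum_compl s]
  by_cases hi : i ∈ s
  · rw [Finset.sum_eq_zero, Finset.sum_congr rfl (g := fun _ => w * -√(s.card : ℝ))]
    · simp only [Finset.sum_const, nsmul_eq_mul, hi, if_true]
      linear_combination (w * √(s.card : ℝ)) * hq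
    · intro j hj
      simp [bipartiteNetwork, hi, Finset.mem_compl.1 hj]
    · intro j hj
      simp [bipartiteNetwork, hi, hj]
  · rw [Finset.sum_congr rfl (g := fun _ => w * √(sᶜ.card : ℝ)), Finset.sum_eq_zero (s := sᶜ)]
    · simp only [Finset.sum_const, nsmul_eq_mul, hi, if_false]
      linear_combination (-w * √(sᶜ.card : ℝ)) * hp
    · intro j hj
      simp [bipartiteNetwork, hi, Finset.mem_compl.1 hj]
    · intro j hj
      simp [bipartiteNetwork, hi, hj]

theorem mul_le_half_mul_sub_half {p q n : ℕ} (h : p + q = n) : p * q ≤ n / 2 * (n - n / 2) := by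
  rcases Nat.even_or_odd' n with ⟨k, hk | hk⟩
  · have h1 : n / 2 = k := by omega
    have h2 : n - k = k := by omega
    rw [h1, h2]
    zify at *
    nlinarith [sq_nonneg ((p : ℤ) - q)]
  · have h1 : n / 2 = k := by omega
    have h2 : n - k = k + 1 := by omega
    rw [h1, h2]
    -- Since `4pq = n² - (p - q)²`, the odd case needs `p ≠ q`, which holds by parity.
    have h3 : (1 : ℤ) ≤ ((p : ℤ) - q) ^ 2 := by
      have : ((p : ℤ) - q) ≠ 0 := by omega
      have := pow_pos (abs_pos.2 this) 2
      rw [sq_abs] at this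
      omega
    zify at *
    nlinarith

/-- Cauchy–Schwarz on the `p` nonnegative and the `q` negative coordinates separately gives the
factor `√(p * q)` with `p + q = n`, which is largest for a balanced split; AM–GM merges the two
partial norms into `normSq x`. -/
theorem two_mul_posPart_sum_mul_negPart_sum_le (x : Fin n → ℝ) :
    2 * ((∑ i, (x i)⁺) * ∑ i, (x i)⁻) ≤
      √(((n / 2 : ℕ) : ℝ) * ((n - n / 2 : ℕ) : ℝ)) * normSq x := by
  set s : Finset (Fin n) := {i | 0 ≤ x i}
  have hs : ∀ i, i ∈ s ↔ 0 ≤ x i := fun i => by simp [s]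
  have hP : (∑ i, (x i)⁺) ^ 2 ≤ s.card * ∑ i, (x i)⁺ ^ 2 := by
    have hz : ∀ i ∈ Finset.univ, i ∉ s → (x i)⁺ = 0 := fun i _ hi =>
      posPart_eq_zero.2 (not_le.1 fun h => hi ((hs i).2 h)).le
    rw [← Finset.sum_subset s.subset_univ hz, ← Finset.sum_subset s.subset_univ
      (f := fun i => (x i)⁺ ^ 2) fun i hi h => by simp [hz i hi h]]
    exact sq_sum_le_card_mul_sum_sq
  have hN : (∑ i, (x i)⁻) ^ 2 ≤ sᶜ.card * ∑ i, (x i)⁻ ^ 2 := by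
    have hz : ∀ i ∈ Finset.univ, i ∉ sᶜ → (x i)⁻ = 0 := fun i _ hi =>
      negPart_eq_zero.2 ((hs i).1 (by simpa using hi))
    rw [← Finset.sum_subset sᶜ.subset_univ hz, ← Finset.sum_subset sᶜ.subset_univ
      (f := fun i => (x i)⁻ ^ 2) fun i hi h => by simp [hz i hi h]]
    exact sq_sum_le_card_mul_sum_sq
  have hx : normSq x = ∑ i, (x i)⁺ ^ 2 + ∑ i, (x i)⁻ ^ 2 := by
    rw [normSq, ← Finset.sum_add_distrib]
    refine Finset.sum_congr rfl fun i _ => ?_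
    rcases le_total 0 (x i) with h | h
    · rw [posPart_of_nonneg h, negPart_of_nonneg h]; ring
    · rw [posPart_of_nonpos h, negPart_of_nonpos h]; ring
  have hcard : (s.card : ℝ) * sᶜ.card ≤ ((n / 2 : ℕ) : ℝ) * ((n - n / 2 : ℕ) : ℝ) := by
    have h1 : s.card + sᶜ.card = n := by rw [Finset.card_add_card_compl, Fintype.card_fin]
    exact_mod_cast mul_le_half_mul_sub_half h1
  rw [hx]
  set X := ∑ i, (x i)⁺ ^ 2
  set Y := ∑ i, (x i)⁻ ^ 2
  set P := ∑ i, (x i)⁺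
  set N := ∑ i, (x i)⁻
  have hX : 0 ≤ X := Finset.sum_nonneg fun _ _ => sq_nonneg _
  have hY : 0 ≤ Y := Finset.sum_nonneg fun _ _ => sq_nonneg _
  refine le_of_sq_le_sq ?_ (by positivity)
  rw [mul_pow (√_), Real.sq_sqrt (by positivity)]
  calc (2 * (P * N)) ^ 2 = 4 * (P ^ 2 * N ^ 2) := by ring
    _ ≤ 4 * ((s.card * X) * (sᶜ.card * Y)) := by gcongr
    _ = (s.card * sᶜ.card) * (4 * (X * Y)) := by ring
    _ ≤ (s.card * sᶜ.card) * (X + Y) ^ 2 := by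
      gcongr
      nlinarith [sq_nonneg (X - Y)]
    _ ≤ _ := by gcongr

/-- In `-xᵀ g x`, pairs of equal sign contribute nonpositively and can be dropped; each remaining
link is raised to `wbar`, leaving twice the product of the positive and negative mass of `x`. -/
theorem rayleighLE_of_mem_networkSpace_of_nonpos (hg : g ∈ networkSpace n wbar) (hw : 0 ≤ wbar)
    (hφ : φ ≤ 0) :
    RayleighLE (φ • g) (-(φ * wbar * √(((n / 2 : ℕ) : ℝ) * ((n - n / 2 : ℕ) : ℝ)))) := by
  intro x
  rw [Matrix.smul_mulVec, dotProduct_smul, smul_eq_mul, dotProduct_mulVec_eq_sum]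
  have h1 : -∑ i, ∑ j, g i j * (x i * x j) ≤
      ∑ i, ∑ j, wbar * ((x i)⁺ * (x j)⁻ + (x i)⁻ * (x j)⁺) := by
    simp only [← Finset.sum_neg_distrib]
    refine Finset.sum_le_sum fun i _ => Finset.sum_le_sum fun j _ => ?_
    have hgij := hg.2.1 i j
    have hi := posPart_sub_negPart (x i)
    have hj := posPart_sub_negPart (x j)
    have p1 := mul_nonneg (posPart_nonneg (x i)) (posPart_nonneg (x j))
    have p2 := mul_nonneg (negPart_nonneg (x i)) (negPart_nonneg (x j))
    have p3 := mul_nonneg (posPart_nonneg (x i)) (negPart_nonneg (x j))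
    have p4 := mul_nonneg (negPart_nonneg (x i)) (posPart_nonneg (x j))
    calc -(g i j * (x i * x j))
        = g i j * ((x i)⁺ * (x j)⁻ + (x i)⁻ * (x j)⁺)
          - g i j * ((x i)⁺ * (x j)⁺ + (x i)⁻ * (x j)⁻) := by
          conv_lhs => rw [← hi, ← hj]
          ring
      _ ≤ g i j * ((x i)⁺ * (x j)⁻ + (x i)⁻ * (x j)⁺) :=
          sub_le_self _ (mul_nonneg hgij.1 (add_nonneg p1 p2))
      _ ≤ _ := mul_le_mul_of_nonneg_right hgij.2 (add_nonneg p3 p4)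
  have h2 : ∑ i, ∑ j, wbar * ((x i)⁺ * (x j)⁻ + (x i)⁻ * (x j)⁺) =
      wbar * (2 * ((∑ i, (x i)⁺) * ∑ i, (x i)⁻)) := by
    simp only [← Finset.mul_sum, Finset.sum_add_distrib, ← Finset.sum_mul]
    ring
  rw [h2] at h1
  have h3 := h1.trans (mul_le_mul_of_nonneg_left (two_mul_posPart_sum_mul_negPart_sum_le x) hw)
  nlinarith [mul_le_mul_of_nonneg_left h3 (neg_nonneg.2 hφ)]

theorem exists_bipartite_eigenvector (hn : 1 ≤ n) (hw : 0 ≤ wbar) (φ : ℝ) :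
    ∃ g ∈ networkSpace n wbar, ∃ u : Fin n → ℝ, u ≠ 0 ∧ (φ • g) *ᵥ u =
      (-(φ * wbar * √(((n / 2 : ℕ) : ℝ) * ((n - n / 2 : ℕ) : ℝ)))) • u := by
  obtain ⟨s, -, hs⟩ := Finset.exists_subset_card_eq (s := (Finset.univ : Finset (Fin n)))
    (n := n / 2) (by simpa using Nat.div_le_self n 2)
  have hsc : sᶜ.card = n - n / 2 := by rw [Finset.card_compl, hs, Fintype.card_fin]
  refine ⟨_, bipartiteNetwork_mem s hw, ?_⟩
  -- For `n = 1` the set `s` is empty and the bipartite eigenvector is zero; the network is zero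
  -- too, so any nonzero vector serves.
  rcases hn.eq_or_lt with rfl | hn2
  · refine ⟨1, one_ne_zero, ?_⟩
    have : bipartiteNetwork s wbar = 0 := by
      ext i j
      rw [Subsingleton.elim i j]
      simp [bipartiteNetwork]
    simp [this]
  · refine ⟨fun i => if i ∈ s then √(sᶜ.card : ℝ) else -√(s.card : ℝ), ?_, ?_⟩
    · obtain ⟨i, hi⟩ : s.Nonempty := Finset.card_pos.1 (by omega)
      intro h
      have h1 := congrFun h i
      have h2 : (0 : ℝ) < sᶜ.card := by rw [hsc]; exact_mod_cast (by omega : 0 < n - n / 2)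
      simp only [hi, if_true, Pi.zero_apply] at h1
      exact (Real.sqrt_pos.2 h2).ne' h1
    · rw [Matrix.smul_mulVec, bipartiteNetwork_mulVec, smul_smul, hs, hsc]
      congr 1
      ring

theorem floor_half_mul_ceil_half (n : ℕ) : (⌊(n : ℝ) / 2⌋₊ : ℝ) * (⌈(n : ℝ) / 2⌉₊ : ℝ) =
    ((n / 2 : ℕ) : ℝ) * ((n - n / 2 : ℕ) : ℝ) := by
  have h1 : ⌊(n : ℝ) / 2⌋₊ = n / 2 := Nat.floor_div_ofNat _ _ |>.trans (by simp)
  have h2 : ⌈(n : ℝ) / 2⌉₊ = n - n / 2 := by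
    rcases Nat.even_or_odd' n with ⟨k, hk | hk⟩
    · have : n - n / 2 = k := by omega
      rw [this, hk]
      push_cast
      rw [mul_div_cancel_left₀ _ two_ne_zero, Nat.ceil_natCast]
    · have : n - n / 2 = k + 1 := by omega
      rw [this, hk, Nat.ceil_eq_iff (by omega)]
      push_cast
      constructor <;> linarith
  rw [h1, h2]

/-- The square root is `n / 2` for even `n` and `√(n² - 1) / 2` for odd `n`, so the weight bound
says exactly that the extremal eigenvalue is below `1`. -/
theorem WeightBound.neg_mul_sqrt_lt_one (h : WeightBound n φ wbar) (hφ : φ < 0) :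
    -(φ * wbar * √(((n / 2 : ℕ) : ℝ) * ((n - n / 2 : ℕ) : ℝ))) < 1 := by
  rcases Nat.even_or_odd' n with ⟨k, hk | hk⟩
  · have h1 : n / 2 = k := by omega
    have h2 : n - k = k := by omega
    have h3 := h.2.1 hφ ⟨k, by omega⟩
    rw [h1, h2, Real.sqrt_mul_self (Nat.cast_nonneg k)]
    rw [hk] at h3
    push_cast at h3
    linarith
  · have h1 : n / 2 = k := by omega
    have h2 : n - k = k + 1 := by omega
    have h3 := h.2.2 hφ ⟨k, hk⟩
    have h4 : (n : ℝ) ^ 2 - 1 = 2 ^ 2 * ((k : ℝ) * ((k + 1 : ℕ) : ℝ)) := by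
      rw [hk]; push_cast; ring
    rw [h4, Real.sqrt_mul (by positivity), Real.sqrt_sq (by positivity)] at h3
    rw [h1, h2]
    linarith

end NetworkIntervention

/-! ### The two interventions. -/

theorem proposition1 (n : ℕ) (hn : 1 ≤ n) (φ wbar : ℝ)
    (ghat : Matrix (Fin n) (Fin n) ℝ) (hghat : ghat ∈ networkSpace n wbar)
    (ahat : Fin n → ℝ) :
    (lambdaMax (φ • ghat) < 1 →
      (∀ C : ℝ, 0 ≤ C → IsGreatest (singleValues φ ghat ahat C) (Vsingle φ ghat ahat C)) ∧
      Tendsto (fun C : ℝ => Vsingle φ ghat ahat C / C) atTop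
        (𝓝 (1 / (1 - lambdaMax (φ • ghat)) ^ 2))) ∧
    (WeightBound n φ wbar →
      (∀ g ∈ networkSpace n wbar, lambdaMax (φ • g) < 1) ∧
      ∀ κ : ℝ, 0 < κ →
        (∀ C : ℝ, 0 ≤ C →
          IsGreatest (jointValues φ wbar κ ghat ahat C) (Vjoint φ wbar κ ghat ahat C)) ∧
        (0 < φ → Tendsto (fun C : ℝ => Vjoint φ wbar κ ghat ahat C / C) atTop
          (𝓝 (1 / (1 - ((n : ℝ) - 1) * φ * wbar) ^ 2))) ∧
        (φ < 0 → Tendsto (fun C : ℝ => Vjoint φ wbar κ ghat ahat C / C) atTop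
          (𝓝 (1 / (1 + φ * wbar *
            Real.sqrt ((⌊(n : ℝ) / 2⌋₊ : ℝ) * (⌈(n : ℝ) / 2⌉₊ : ℝ))) ^ 2)))) := by
  -- Nonnegativity of `wbar` comes from `networkSpace n wbar` containing `ghat`.
  have hw : 0 ≤ wbar := (hghat.2.1 ⟨0, hn⟩ ⟨0, hn⟩).1.trans (hghat.2.1 ⟨0, hn⟩ ⟨0, hn⟩).2
  have hsm : ∀ g ∈ networkSpace n wbar, ∀ i j, (φ • g) i j = (φ • g) j i := fun g hg i j => by
    simp [hg.1 i j]
  refine ⟨fun hlam => ?_, fun hW => ?_⟩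
  · have hR : ∀ g ∈ ({ghat} : Set (Matrix (Fin n) (Fin n) ℝ)),
        RayleighLE (φ • g) (lambdaMax (φ • ghat)) := by
      rintro g rfl
      exact rayleighLE_lambdaMax hn (hsm g hghat)
    have hsymm : ∀ g ∈ ({ghat} : Set (Matrix (Fin n) (Fin n) ℝ)), ∀ i j, g i j = g j i := by
      rintro g rfl
      exact hghat.1
    obtain ⟨u, hu, hgu⟩ :=
      exists_eigenvector_of_mem_spectrum (isGreatest_lambdaMax hn (hsm ghat hghat)).1
    simp only [Vsingle, singleValues_eq]
    exact ⟨fun C hC => isGreatest_valuesOn isCompact_singleton rfl one_pos hsymm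
      (fun g hg => (hR g hg).isUnit_det hlam) hC,
      tendsto_sSup_valuesOn isCompact_singleton rfl one_pos hsymm hR hlam rfl hu hgu⟩
  -- One `L < 1` for the whole network space suffices for the spectral bound and attainment. The
  -- case `φ = 0` belongs here as well, with `L = 0`.
  · obtain ⟨L, hL, hR⟩ : ∃ L < 1, ∀ g ∈ networkSpace n wbar, RayleighLE (φ • g) L := by
      rcases le_or_gt 0 φ with hφ | hφ
      · refine ⟨_, ?_, fun g hg => rayleighLE_of_mem_networkSpace hg hφ⟩
        rcases hφ.eq_or_lt with rfl | hφ
        · simp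
        · linarith [hW.1 hφ]
      · exact ⟨_, hW.neg_mul_sqrt_lt_one hφ,
          fun g hg => rayleighLE_of_mem_networkSpace_of_nonpos hg hw hφ.le⟩
    have hsymm : ∀ g ∈ networkSpace n wbar, ∀ i j, g i j = g j i := fun g hg => hg.1
    refine ⟨fun g hg => ((hR g hg).lambdaMax_le hn (hsm g hg)).trans_lt hL,
      fun κ hκ => ⟨fun C hC => ?_, fun hφ => ?_, fun hφ => ?_⟩⟩
    · exact isGreatest_valuesOn (isCompact_networkSpace n wbar) hghat hκ hsymm
        (fun g hg => (hR g hg).isUnit_det hL) hC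
    · have hne : (1 : Fin n → ℝ) ≠ 0 := fun h => one_ne_zero (congrFun h ⟨0, hn⟩)
      refine tendsto_sSup_valuesOn (isCompact_networkSpace n wbar) hghat hκ hsymm
        (fun g hg => rayleighLE_of_mem_networkSpace hg hφ.le) (by linarith [hW.1 hφ])
        (completeNetwork_mem hw) hne ?_
      rw [Matrix.smul_mulVec, completeNetwork_mulVec_one, smul_smul]
      congr 1
      ring
    · obtain ⟨g, hg, u, hu, hgu⟩ := exists_bipartite_eigenvector hn hw φ
      have := tendsto_sSup_valuesOn (ahat := ahat) (isCompact_networkSpace n wbar) hghat hκ hsymm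
        (fun g hg => rayleighLE_of_mem_networkSpace_of_nonpos hg hw hφ.le)
        (hW.neg_mul_sqrt_lt_one hφ) hg hu hgu
      rwa [sub_neg_eq_add, ← floor_half_mul_ceil_half] at this
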